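/- Let $d\ge 0$ and $n\ge d+1$ be integers, put $k=n-d-1$, let $\mathcal A=\{a_1,\dots,a_n\}\subset\mathbb R^d$ be a set of $n$ distinct points, and let $A\in\mathbb R^{(d+1)\times n}$ be the matrix with columns $(1,a_1),\dots,(1,a_n)$. Let $C=(c_{ij})\in\mathbb R^{d\times n}$ have columns $C_1,\dots,C_n$. Assume that $A$ and $C$ are uniform, that is, none of their maximal minors vanishes. Let $B\in\mathbb R^{n\times k}$ be a Gale dual matrix of $A$, that is, a matrix whose columns $B_1,\dots,B_k$ form a basis of $\ker(A)$, and assume that $B$ is dominating: no nonempty square submatrix of $B$ has a strictly positive and a strictly negative entry in each of its columns (for $k=0$ the empty matrix $B$ is dominating). Assume moreover that $$\mathbf 0\in\mathcal C^\circ=\mathbb R_{>0}C_1+\dots+\mathbb R_{>0}C_n$$ and that for every $j=1,\dots,k$ there is a vector $v\in\ker(C)$ with $\operatorname{sign}(v)=\operatorname{sign}(B_j)$, where the sign of a vector is the vector in $\{-1,0,1\}^n$ of the signs of its coordinates. Then the system $$\sum_{j=1}^n c_{ij}\,x^{a_j}=0,\qquad i=1,\dots,d,$$ where $x^{a_j}=\prod_{l=1}^d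 x_l^{a_{j,l}}$ with real exponents, has at least one solution $x\in\mathbb R_{>0}^d$; that is, the (possibly infinite) number $n_{\mathcal A}(C)$ of its positive solutions satisfies $n_{\mathcal A}(C)>0$. -/

import Mathlib

open scoped Matrix

/-- An `r × s` matrix with `r ≤ s` is uniform if none of its maximal minors vanishes.  The columns
of a minor are listed by an injection; reordering them only changes the sign of the determinant. -/
def IsUniform {r s : ℕ} (M : Matrix (Fin r) (Fin s) ℝ) : Prop :=
  r ≤ s ∧ ∀ f : Fin r ↪ Fin s, (M.submatrix id f).det ≠ 0

/-- `N` is a Gale dual matrix of `M`: the `r × s` matrix `M` has maximal rank `r`, the matrix `N` has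
size `s × (s - r)`, and the columns of `N` form a basis of the kernel of `M`. -/
def IsGaleDual {r s t : ℕ} (M : Matrix (Fin r) (Fin s) ℝ) (N : Matrix (Fin s) (Fin t) ℝ) : Prop :=
  M.rank = r ∧ r + t = s ∧ LinearIndependent ℝ N.col ∧
    Submodule.span ℝ (Set.range N.col) = LinearMap.ker M.mulVecLin

/-- A vector is mixed if it has a strictly positive and a strictly negative coordinate. -/
def IsMixedVec {ι : Type*} (v : ι → ℝ) : Prop :=
  (∃ i, 0 < v i) ∧ ∃ i, v i < 0

/-- A matrix is mixed if every column is a mixed vector (so a matrix without columns is mixed). -/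
def IsMixed {ι κ : Type*} (M : Matrix ι κ ℝ) : Prop :=
  ∀ j, IsMixedVec (M.col j)

/-- A matrix is dominating if it contains no (nonempty) square mixed submatrix. -/
def IsDominating {ι κ : Type*} (M : Matrix ι κ ℝ) : Prop :=
  ∀ (r : ℕ), 0 < r → ∀ (f : Fin r ↪ ι) (g : Fin r ↪ κ), ¬ IsMixed (M.submatrix f g)

/-- The `(d + 1) × n` matrix with columns `(1, a₁), …, (1, aₙ)`. -/
def configMatrix {d n : ℕ} (a : Fin n → Fin d → ℝ) : Matrix (Fin (d + 1)) (Fin n) ℝ :=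
  Matrix.of fun i j => (Fin.cons 1 (a j) : Fin (d + 1) → ℝ) i

/-- The cone of all linear combinations, with strictly positive coefficients, of the columns. -/
def openCone {d n : ℕ} (C : Matrix (Fin d) (Fin n) ℝ) : Set (Fin d → ℝ) :=
  {v | ∃ c : Fin n → ℝ, (∀ j, 0 < c j) ∧ v = ∑ j, c j • C.col j}

/-- The coordinatewise sign of a vector. -/
noncomputable def signVec {n : ℕ} (v : Fin n → ℝ) : Fin n → SignType :=
  fun i => SignType.sign (v i)

/-- The positive solutions of the generalized polynomial system
`∑ j, c i j * x ^ (a j) = 0` for `i = 1, …, d`. -/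
def positiveSolutions {d n : ℕ} (a : Fin n → Fin d → ℝ) (C : Matrix (Fin d) (Fin n) ℝ) :
    Set (Fin d → ℝ) :=
  {x | (∀ l, 0 < x l) ∧ ∀ i, ∑ j, C i j * ∏ l, x l ^ a j l = 0}

/-- The (possibly infinite) number of positive solutions of the system. -/
noncomputable def numPositiveSolutions {d n : ℕ} (a : Fin n → Fin d → ℝ)
    (C : Matrix (Fin d) (Fin n) ℝ) : ℕ∞ :=
  (positiveSolutions a C).encard

/-! Up to a common factor, `(x^{a_j})_j` ranges over the positive vectors whose logarithm lies in
the row space of `configMatrix a`, that is, is orthogonal to the columns of `B`. So it suffices to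
find a positive vector in `ker C` with this property. Take a positive `w` in `ker C` and let the
columns of `D` be kernel vectors with the signs of those of `B`. The point is sought in the form `w
+ D y`. Domination depends only on signs, so it passes to `D`; since the columns are also mixed, the
region `w + D y ≥ 0` is bounded (`IsDominating.exists_mulVec_neg`, `exists_bound_of_mulVec_neg`).
With truncated logarithms, Brouwer's theorem solves a complementarity problem on a box around this
region (`exists_box_complementarity`). If a coordinate of the solution were tiny, the signs of `D y`
and of `B` would force an alternating cycle of tiny coordinates, excluded by
`IsDominating.not_alternating`. So the truncation is inactive, the point lies inside the box, and
the equations hold exactly. -/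

/-! ### Brouwer's fixed point theorem, by integrating a Jacobian. -/

/-- Polynomial interpolation of `t ↦ det (1 + t • f)`, with weights that do not depend on `f`. -/
theorem exists_det_one_add_eq_sum (E : Type*) [NormedAddCommGroup E] [NormedSpace ℝ E]
    [FiniteDimensional ℝ E] {t : Fin (Module.finrank ℝ E + 1) → ℝ}
    (ht : Function.Injective t) :
    ∃ c : Fin (Module.finrank ℝ E + 1) → ℝ, ∑ i, c i = 1 ∧
      ∀ f : E →L[ℝ] E, (1 + f).det = ∑ i, c i * (1 + t i • f).det := by
  classical
  refine ⟨fun i => (Lagrange.basis Finset.univ t i).eval 1, ?_, fun f => ?_⟩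
  · rw [← Polynomial.eval_finsetSum, Lagrange.sum_basis ht.injOn Finset.univ_nonempty]
    simp
  · let b := Module.finBasis ℝ E
    let M := LinearMap.toMatrix b b (f : E →ₗ[ℝ] E)
    -- The degree is at most `finrank ℝ E`, so the `finrank ℝ E + 1` nodes determine `p`.
    let p : Polynomial ℝ := Matrix.det
      ((Polynomial.X : Polynomial ℝ) • M.map Polynomial.C + (1 : Matrix _ _ ℝ).map Polynomial.C)
    have heval : ∀ s : ℝ, p.eval s = (1 + s • f).det := by
      intro s
      have h1 : (1 + s • f).det = (1 + s • M).det := by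
        change LinearMap.det ((1 + s • f : E →L[ℝ] E) : E →ₗ[ℝ] E) = _
        rw [← LinearMap.det_toMatrix b]
        congr 1
        have : ((1 + s • f : E →L[ℝ] E) : E →ₗ[ℝ] E) = LinearMap.id + s • (f : E →ₗ[ℝ] E) := rfl
        rw [this, map_add, map_smul, LinearMap.toMatrix_id]
      rw [h1]
      change Polynomial.evalRingHom s _ = _
      rw [RingHom.map_det]
      congr 1
      ext i j
      simp [Matrix.one_apply, apply_ite (Polynomial.eval s), add_comm]
      exact mul_comm _ _
    have hdeg : p.degree < (Finset.univ : Finset (Fin (Module.finrank ℝ E + 1))).card := by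
      refine lt_of_le_of_lt Polynomial.degree_le_natDegree ?_
      have := Polynomial.natDegree_det_X_add_C_le M 1
      rw [Fintype.card_fin] at this
      rw [Finset.card_univ, Fintype.card_fin]
      exact_mod_cast Nat.lt_succ_of_le this
    have h := congrArg (Polynomial.eval 1)
      (Lagrange.eq_interpolate (v := t) ht.injOn hdeg)
    rw [heval 1, one_smul, Lagrange.interpolate_apply, Polynomial.eval_finsetSum] at h
    rw [h]
    refine Finset.sum_congr rfl fun i _ => ?_
    rw [Polynomial.eval_mul, Polynomial.eval_C, heval, mul_comm]

section Brouwer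

open Metric MeasureTheory
open scoped NNReal

variable {E : Type*} [NormedAddCommGroup E]

theorem exists_norm_eq_dist_le [NormedSpace ℝ E] {R : ℝ} {x y : E} (hx : ‖x‖ ≤ R)
    (hy : R ≤ ‖y‖) :
    ∃ z, ‖z‖ = R ∧ dist x z ≤ dist x y := by
  have hcont : ContinuousOn (fun s : ℝ => ‖AffineMap.lineMap x y s‖) (Set.Icc 0 1) :=
    (AffineMap.lineMap_continuous.norm).continuousOn
  obtain ⟨s, hs, hsR⟩ := intermediate_value_Icc zero_le_one hcont
    (show R ∈ Set.Icc _ _ by simpa using ⟨hx, hy⟩)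
  refine ⟨AffineMap.lineMap x y s, hsR, ?_⟩
  rw [dist_left_lineMap, Real.norm_of_nonneg hs.1]
  exact mul_le_of_le_one_left dist_nonneg hs.2

/-- A segment leaving the ball crosses the sphere, where `g` vanishes, so extension by zero keeps
the constant `K`. -/
theorem LipschitzOnWith.lipschitzWith_indicator_ball [NormedSpace ℝ E] {R : ℝ} {K : ℝ≥0}
    {g : E → E} (hg : LipschitzOnWith K g (closedBall 0 R)) (h0 : ∀ x, ‖x‖ = R → g x = 0) :
    LipschitzWith K ((ball (0 : E) R).indicator g) := by
  have key : ∀ x ∈ ball (0 : E) R, ∀ y ∉ ball (0 : E) R, dist (g x) 0 ≤ K * dist x y := by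
    intro x hx y hy
    rw [mem_ball_zero_iff] at hx hy
    obtain ⟨z, hz, hxz⟩ := exists_norm_eq_dist_le hx.le (not_lt.1 hy)
    rw [← h0 z hz]
    refine (hg.dist_le_mul x (by simpa using hx.le) z (by simpa using hz.le)).trans ?_
    gcongr
  refine LipschitzWith.of_dist_le_mul fun x y => ?_
  by_cases hx : x ∈ ball (0 : E) R <;> by_cases hy : y ∈ ball (0 : E) R
  · rw [Set.indicator_of_mem hx, Set.indicator_of_mem hy]
    exact hg.dist_le_mul x (ball_subset_closedBall hx) y (ball_subset_closedBall hy)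
  · rw [Set.indicator_of_mem hx, Set.indicator_of_notMem hy]
    exact key x hx y hy
  · rw [Set.indicator_of_notMem hx, Set.indicator_of_mem hy, dist_comm, dist_comm x]
    exact key y hy x hx
  · rw [Set.indicator_of_notMem hx, Set.indicator_of_notMem hy, dist_self]
    positivity

/-- A small Lipschitz perturbation of the identity supported in a ball permutes that ball. -/
theorem LipschitzWith.injective_and_image_ball [NormedSpace ℝ E] [CompleteSpace E] {R : ℝ}
    {K : ℝ≥0} {h : E → E} (hh : LipschitzWith K h) (hK : K < 1)
    (h0 : ∀ x ∉ ball (0 : E) R, h x = 0) :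
    Function.Injective (fun x => x + h x) ∧
      (fun x => x + h x) '' ball (0 : E) R = ball 0 R := by
  have hA : ApproximatesLinearOn (fun x => x + h x)
      ((ContinuousLinearEquiv.refl ℝ E : E ≃L[ℝ] E) : E →L[ℝ] E) Set.univ K := by
    intro x _ y _
    have := hh.dist_le_mul x y
    rw [dist_eq_norm, dist_eq_norm] at this
    refine le_of_eq_of_le (congrArg norm ?_) this
    change x + h x - (y + h y) - (x - y) = h x - h y
    abel
  have hc : Subsingleton E ∨
      K < ‖((ContinuousLinearEquiv.refl ℝ E).symm : E →L[ℝ] E)‖₊⁻¹ := by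
    rcases subsingleton_or_nontrivial E with hE | hE
    · exact Or.inl hE
    · right
      have : ‖((ContinuousLinearEquiv.refl ℝ E).symm : E →L[ℝ] E)‖₊ = 1 := by
        ext; exact ContinuousLinearMap.norm_id
      rw [this, inv_one]
      exact hK
  have hinj : Function.Injective (fun x => x + h x) :=
    fun x y => hA.injOn hc (Set.mem_univ x) (Set.mem_univ y)
  have hsurj := hA.surjective hc
  refine ⟨hinj, Set.Subset.antisymm ?_ ?_⟩
  · rintro _ ⟨x, hx, rfl⟩
    by_contra hz
    -- A point outside the ball is fixed, so by injectivity it cannot also be the image of a point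
    -- inside.
    have h1 : (fun x => x + h x) (x + h x) = x + h x := by simp [h0 _ hz]
    have h2 : x + h x = x := hinj h1
    exact hz (by change x + h x ∈ _; rwa [h2])
  · intro y hy
    obtain ⟨x, rfl⟩ := hsurj y
    refine ⟨x, ?_, rfl⟩
    by_contra hx
    simp only [h0 x hx, add_zero] at hy
    exact hx hy

variable [InnerProductSpace ℝ E] [FiniteDimensional ℝ E]

/-- For small `t ≥ 0` the map `x + t g x` permutes the ball with positive Jacobian, so the integral
of `det (1 + t g')` is the volume. It is polynomial in `t`, hence interpolation from small nodes
reaches `t = 1`. -/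
theorem integral_det_one_add_fderiv [MeasurableSpace E] [BorelSpace E] {g : E → E} {R : ℝ}
    (hg : ContDiff ℝ 1 g) (h0 : ∀ x, ‖x‖ = R → g x = 0) :
    ∫ x in ball (0 : E) R, (1 + fderiv ℝ g x).det = volume.real (ball (0 : E) R) := by
  have hcont : Continuous (fderiv ℝ g) := hg.continuous_fderiv one_ne_zero
  have hdetc : Continuous (fun f : E →L[ℝ] E => f.det) := ContinuousLinearMap.continuous_det
  obtain ⟨K, hK⟩ : ∃ K : ℝ≥0, ∀ x ∈ closedBall (0 : E) R, ‖fderiv ℝ g x‖₊ ≤ K := by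
    obtain ⟨K, hK⟩ := (isCompact_closedBall (0 : E) R).exists_bound_of_continuousOn
      hcont.continuousOn
    refine ⟨K.toNNReal, fun x hx => ?_⟩
    rw [← NNReal.coe_le_coe, coe_nnnorm]
    exact (hK x hx).trans (Real.le_coe_toNNReal K)
  have hlip : LipschitzOnWith K g (closedBall 0 R) :=
    (convex_closedBall (0 : E) R).lipschitzOnWith_of_nnnorm_fderiv_le
      (fun x _ => (hg.differentiable one_ne_zero) x) hK
  have hind := hlip.lipschitzWith_indicator_ball h0
  obtain ⟨δ, hδ, hpos⟩ : ∃ δ > 0, ∀ f : E →L[ℝ] E, ‖f‖ < δ → 0 < (1 + f).det := by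
    have h1 : (1 : E →L[ℝ] E).det = 1 := LinearMap.det_id
    have hc : ContinuousAt (fun f : E →L[ℝ] E => (1 + f).det) 0 := by
      exact (hdetc.comp (continuous_const.add continuous_id)).continuousAt
    have := hc.eventually (lt_mem_nhds (show (0 : ℝ) < (1 + (0 : E →L[ℝ] E)).det by
      rw [add_zero, h1]; exact one_pos))
    obtain ⟨δ, hδ, H⟩ := Metric.eventually_nhds_iff.1 this
    exact ⟨δ, hδ, fun f hf => H (by simpa using hf)⟩
  have hsmall : ∀ t : ℝ, 0 ≤ t → t * K < 1 → t * K < δ →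
      ∫ x in ball (0 : E) R, (1 + t • fderiv ℝ g x).det = volume.real (ball (0 : E) R) := by
    intro t ht ht1 htδ
    have hlt : LipschitzWith (t.toNNReal * K) (fun x => t • (ball (0 : E) R).indicator g x) := by
      refine LipschitzWith.of_dist_le_mul fun x y => ?_
      rw [dist_smul₀, NNReal.coe_mul, Real.coe_toNNReal t ht, Real.norm_of_nonneg ht, mul_assoc]
      gcongr
      exact hind.dist_le_mul x y
    obtain ⟨hinj, himg⟩ := hlt.injective_and_image_ball (R := R)
      (by rw [← NNReal.coe_lt_coe, NNReal.coe_mul, Real.coe_toNNReal t ht]; exact ht1)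
      (fun x hx => by rw [Set.indicator_of_notMem hx, smul_zero])
    have heq : Set.EqOn (fun x => x + t • (ball (0 : E) R).indicator g x) (fun x => x + t • g x)
        (ball (0 : E) R) := fun x hx => by
      simp only [Set.indicator_of_mem hx]
    have hder : ∀ x ∈ ball (0 : E) R, HasFDerivWithinAt (fun x => x + t • g x)
        (1 + t • fderiv ℝ g x) (ball 0 R) x := fun x _ =>
      ((hasFDerivAt_id x).add
        (((hg.differentiable one_ne_zero) x).hasFDerivAt.const_smul t)).hasFDerivWithinAt
    have h := integral_image_eq_integral_abs_det_fderiv_smul volume measurableSet_ball hder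
      ((heq.injOn_iff).1 hinj.injOn) (fun _ => (1 : ℝ))
    rw [← heq.image_eq, himg] at h
    have h2 : ∫ x in ball (0 : E) R, (1 + t • fderiv ℝ g x).det
        = ∫ x in ball (0 : E) R, |(1 + t • fderiv ℝ g x).det| • (1 : ℝ) := by
      refine setIntegral_congr_fun measurableSet_ball fun x hx => ?_
      have hn : ‖t • fderiv ℝ g x‖ < δ := by
        rw [norm_smul, Real.norm_of_nonneg ht]
        refine lt_of_le_of_lt ?_ htδ
        gcongr
        exact_mod_cast hK x (ball_subset_closedBall hx)
      simp only [smul_eq_mul, mul_one]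
      exact (abs_of_pos (hpos _ hn)).symm
    rw [h2, ← h]
    simp
  obtain ⟨τ, hτ, hτ1, hτδ⟩ : ∃ τ > 0, τ * (K : ℝ) < 1 ∧ τ * K < δ := by
    have hm : 0 < min 1 δ := lt_min one_pos hδ
    have hK1 : (0 : ℝ) < K + 1 := by positivity
    have hlt : min 1 δ / (K + 1) * (K : ℝ) < min 1 δ := by
      rw [div_mul_eq_mul_div, div_lt_iff₀ hK1]
      nlinarith
    exact ⟨min 1 δ / (K + 1), by positivity, hlt.trans_le (min_le_left _ _),
      hlt.trans_le (min_le_right _ _)⟩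
  let m := Module.finrank ℝ E
  let t : Fin (m + 1) → ℝ := fun i => τ * ((i : ℕ) / (m + 1 : ℝ))
  have htinj : Function.Injective t := by
    intro i j hij
    have hm : (m + 1 : ℝ) ≠ 0 := by positivity
    have := mul_left_cancel₀ hτ.ne' hij
    rw [div_left_inj' hm] at this
    exact Fin.ext (by exact_mod_cast this)
  have ht0 : ∀ i, 0 ≤ t i := fun i => mul_nonneg hτ.le (by positivity)
  have htτ : ∀ i, t i ≤ τ := fun i => by
    refine mul_le_of_le_one_right hτ.le ((div_le_one (by positivity)).2 ?_)
    exact_mod_cast i.2.le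
  obtain ⟨c, hc1, hc⟩ := exists_det_one_add_eq_sum E htinj
  have hint : ∀ s : ℝ, IntegrableOn (fun x => (1 + s • fderiv ℝ g x).det) (ball (0 : E) R) := by
    intro s
    have : Continuous (fun x => (1 + s • fderiv ℝ g x).det) :=
      hdetc.comp (continuous_const.add (hcont.const_smul s))
    exact (this.continuousOn.integrableOn_compact (isCompact_closedBall 0 R)).mono_set
      ball_subset_closedBall
  rw [show (fun x => (1 + fderiv ℝ g x).det) = fun x => ∑ i, c i * (1 + t i • fderiv ℝ g x).det
    from funext fun x => hc _]
  rw [integral_finsetSum _ fun i _ => (hint (t i)).const_mul (c i)]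
  simp_rw [integral_const_mul]
  rw [Finset.sum_congr rfl fun i _ => by
    rw [hsmall (t i) (ht0 i)
      (lt_of_le_of_lt (by gcongr; exact htτ i) hτ1) (lt_of_le_of_lt (by gcongr; exact htτ i) hτδ)]]
  rw [← Finset.sum_mul, hc1, one_mul]

/-- There is no continuously differentiable retraction of a ball onto its boundary sphere. -/
theorem not_exists_contDiff_retraction {f : E → E} {R : ℝ} (hR : 0 < R) (hf : ContDiff ℝ 1 f)
    (hid : ∀ x, ‖x‖ = R → f x = x) : ¬ ∀ x, ‖x‖ < R → ‖f x‖ = R := by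
  intro hsph
  borelize E
  have hg : ContDiff ℝ 1 (fun x => f x - x) := hf.sub contDiff_id
  have h := integral_det_one_add_fderiv (R := R) hg fun x hx => by simp [hid x hx]
  have hzero : ∫ x in ball (0 : E) R, (1 + fderiv ℝ (fun x => f x - x) x).det = 0 := by
    rw [setIntegral_congr_fun (g := fun _ => (0 : ℝ)) measurableSet_ball, integral_zero]
    intro x hx
    have hfx := (hf.differentiable one_ne_zero) x
    have hd : 1 + fderiv ℝ (fun x => f x - x) x = fderiv ℝ f x := by
      have : HasFDerivAt (fun x => f x - x) (fderiv ℝ f x - 1) x :=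
        hfx.hasFDerivAt.sub (hasFDerivAt_id x)
      rw [this.fderiv]
      abel
    change (1 + fderiv ℝ (fun x => f x - x) x).det = 0
    rw [hd]
    by_contra hne
    have hunit : IsUnit (LinearMap.det ((fderiv ℝ f x : E →L[ℝ] E) : E →ₗ[ℝ] E)) :=
      isUnit_iff_ne_zero.2 hne
    -- Differentiating `‖f‖² = R²` makes `f x` orthogonal to the range of the derivative; were that
    -- surjective, `f x` would be orthogonal to itself.
    have hconst : (fun y => inner ℝ (f y) (f y)) =ᶠ[nhds x] fun _ => R ^ 2 := by
      filter_upwards [isOpen_ball.mem_nhds hx] with y hy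
      rw [real_inner_self_eq_norm_sq, hsph y (mem_ball_zero_iff.1 hy)]
    have hder := (hfx.hasFDerivAt.inner ℝ hfx.hasFDerivAt).congr_of_eventuallyEq hconst.symm
    have hz := hder.unique (hasFDerivAt_const (R ^ 2) x)
    obtain ⟨v, hv⟩ := (LinearEquiv.ofIsUnitDet (f := ((fderiv ℝ f x : E →L[ℝ] E) : E →ₗ[ℝ] E))
      (v := Module.finBasis ℝ E) (v' := Module.finBasis ℝ E)
      (by rwa [LinearMap.det_toMatrix])).surjective (f x)
    have hv' : fderiv ℝ f x v = f x := hv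
    have h3 := congrArg (fun l : E →L[ℝ] ℝ => l v) hz
    simp [fderivInnerCLM_apply, hv', hsph x (mem_ball_zero_iff.1 hx)] at h3
    exact hR.ne' h3
  rw [hzero] at h
  have hp : 0 < volume.real (ball (0 : E) R) :=
    ENNReal.toReal_pos (measure_ball_pos _ _ hR).ne' measure_ball_lt_top.ne
  exact hp.ne h

/-- Without fixed points, `x - χ x • φ x` never vanishes and is the identity on the sphere of radius
`ρ + 2`; its radial projection would be a retraction. -/
theorem exists_fixedPoint_of_contDiff_of_bounded {φ : E → E} {ρ : ℝ} (hφ : ContDiff ℝ 1 φ)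
    (hρ : ∀ x, ‖φ x‖ ≤ ρ) : ∃ x, φ x = x := by
  by_contra! hne
  have hρ0 : 0 ≤ ρ := (norm_nonneg _).trans (hρ 0)
  let χ : ContDiffBump (0 : E) := ⟨ρ + 1, ρ + 2, by linarith, by linarith⟩
  let H : E → E := fun x => x - χ x • φ x
  have hH : ContDiff ℝ 1 H := contDiff_id.sub (χ.contDiff.smul hφ)
  have hH0 : ∀ x, H x ≠ 0 := by
    intro x hx
    have hx' : x = χ x • φ x := sub_eq_zero.1 hx
    by_cases hle : ‖x‖ ≤ ρ + 1
    · rw [χ.one_of_mem_closedBall (by simpa using hle), one_smul] at hx'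
      exact hne x hx'.symm
    · have h1 : ‖x‖ ≤ ρ := by
        rw [hx', norm_smul, Real.norm_of_nonneg χ.nonneg]
        exact (mul_le_of_le_one_left (norm_nonneg _) χ.le_one).trans (hρ x)
      linarith
  have hR : 0 < ρ + 2 := by linarith
  refine not_exists_contDiff_retraction (f := fun x => ((ρ + 2) * ‖H x‖⁻¹) • H x) hR
    ((contDiff_const.mul ((hH.norm ℝ hH0).inv fun x => norm_ne_zero_iff.2 (hH0 x))).smul hH)
    (fun x hx => ?_) fun x _ => ?_
  · have : H x = x := by
      simp only [H]
      rw [χ.zero_of_le_dist (by simp [χ, hx]), zero_smul, sub_zero]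
    simp only [this, hx, mul_inv_cancel₀ hR.ne', one_smul]
  · rw [norm_smul, norm_mul, norm_inv, norm_norm, mul_assoc,
      inv_mul_cancel₀ (norm_ne_zero_iff.2 (hH0 x)), mul_one, Real.norm_of_nonneg hR.le]

/-- **Brouwer's fixed point theorem** for bounded continuous maps of a Euclidean space. -/
theorem exists_fixedPoint_of_continuous_of_bounded {φ : E → E} {ρ : ℝ} (hφ : Continuous φ)
    (hρ : ∀ x, ‖φ x‖ ≤ ρ) : ∃ x, φ x = x := by
  by_contra! hne
  have hρ0 : 0 ≤ ρ := (norm_nonneg _).trans (hρ 0)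
  -- The minimum of `‖φ x - x‖` on the ball bounds the smoothing error; a fixed point of the
  -- approximation lies in this ball and violates the minimum.
  obtain ⟨z, -, hz⟩ := (isCompact_closedBall (0 : E) (ρ + 1)).exists_isMinOn
    ⟨0, by simp; linarith⟩ ((hφ.sub continuous_id).norm.continuousOn)
  have hε : 0 < min 1 ‖φ z - z‖ :=
    lt_min one_pos (norm_pos_iff.2 (sub_ne_zero.2 (hne z)))
  obtain ⟨ψ, hψ, hd, -⟩ := hφ.exists_contDiff_approx 1
    (continuous_const (y := min 1 ‖φ z - z‖)) (fun _ => hε)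
  have hψρ : ∀ x, ‖ψ x‖ ≤ ρ + 1 := fun x => by
    have h1 := hd x
    rw [dist_eq_norm] at h1
    calc ‖ψ x‖ = ‖(ψ x - φ x) + φ x‖ := by rw [sub_add_cancel]
      _ ≤ ‖ψ x - φ x‖ + ‖φ x‖ := norm_add_le _ _
      _ ≤ ρ + 1 := by linarith [hρ x, min_le_left 1 ‖φ z - z‖]
  obtain ⟨x, hx⟩ := exists_fixedPoint_of_contDiff_of_bounded (by exact_mod_cast hψ) hψρ
  have hxm : x ∈ closedBall (0 : E) (ρ + 1) := by
    rw [mem_closedBall_zero_iff, ← hx]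
    exact hψρ x
  have h1 : ‖φ z - z‖ ≤ ‖φ x - x‖ := hz hxm
  have h2 := hd x
  rw [hx, dist_comm, dist_eq_norm] at h2
  exact absurd (h2.trans_le (min_le_right _ _)) (not_lt.2 h1)

end Brouwer

/-! ### Complementarity on a box, and dominating matrices. -/

/-- A continuous vector field on a box satisfies the complementarity conditions at some point. -/
theorem exists_box_complementarity {ι : Type*} [Fintype ι] {G : (ι → ℝ) → ι → ℝ}
    (hG : Continuous G) {R : ℝ} (hR : 0 < R) :
    ∃ y : ι → ℝ, ∀ j, |y j| ≤ R ∧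
      (G y j = 0 ∨ (y j = R ∧ G y j ≤ 0) ∨ (y j = -R ∧ 0 ≤ G y j)) := by
  -- Clamping `y - G y` to the box: a fixed point moves only where the clamp is active.
  let φ : EuclideanSpace ℝ ι → EuclideanSpace ℝ ι := fun y =>
    WithLp.toLp 2 fun j => max (-R) (min R (y j - G y.ofLp j))
  have hφ : Continuous φ := by
    refine (PiLp.continuous_toLp 2 _).comp (continuous_pi fun j => ?_)
    have h1 : Continuous fun y : EuclideanSpace ℝ ι => G y.ofLp j :=
      (continuous_apply j).comp (hG.comp (PiLp.continuous_ofLp 2 _))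
    fun_prop
  have hb : ∀ y, ‖φ y‖ ≤ Real.sqrt (∑ _j : ι, R ^ 2) := fun y => by
    rw [EuclideanSpace.norm_eq]
    refine Real.sqrt_le_sqrt (Finset.sum_le_sum fun j _ => ?_)
    rw [Real.norm_eq_abs]
    refine pow_le_pow_left₀ (abs_nonneg _) (abs_le.2 ⟨le_max_left _ _, ?_⟩) 2
    exact max_le (by linarith) (min_le_left _ _)
  obtain ⟨y, hy⟩ := exists_fixedPoint_of_continuous_of_bounded hφ hb
  refine ⟨y.ofLp, fun j => ?_⟩
  have hj : max (-R) (min R (y j - G y.ofLp j)) = y j :=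
    congrArg (fun z : EuclideanSpace ℝ ι => z j) hy
  have hlo : -R ≤ y j := hj ▸ le_max_left _ _
  have hhi : y j ≤ R := hj ▸ max_le (by linarith) (min_le_left _ _)
  refine ⟨abs_le.2 ⟨hlo, hhi⟩, ?_⟩
  rcases le_total R (y j - G y.ofLp j) with h1 | h1
  · rw [min_eq_left h1, max_eq_right (by linarith)] at hj
    exact Or.inr (Or.inl ⟨hj.symm, by linarith⟩)
  · rw [min_eq_right h1] at hj
    rcases le_total (-R) (y j - G y.ofLp j) with h2 | h2
    · rw [max_eq_right h2] at hj
      exact Or.inl (by linarith)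
    · rw [max_eq_left h2] at hj
      exact Or.inr (Or.inr ⟨hj.symm, by linarith⟩)

/-- The alternating digraph of a dominating matrix, with columns rescaled by `ε`, has no nonempty
finite set of rows closed under walking. -/
theorem IsDominating.not_alternating {ι κ : Type*} {M : Matrix ι κ ℝ} (hM : IsDominating M)
    (ε : κ → ℝ) {S : Set ι} (hfin : S.Finite) (hne : S.Nonempty)
    (hcol : ∀ i ∈ S, ∃ j, ε j * M i j < 0)
    (hrow : ∀ i ∈ S, ∀ j, ε j * M i j < 0 → ∃ i' ∈ S, 0 < ε j * M i' j) : False := by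
  classical
  have : Finite S := hfin
  have : Nonempty S := hne.to_subtype
  choose f hf using fun i : S => hcol i i.2
  have hg : ∀ j, ∃ i' : S, (∃ i ∈ S, ε j * M i j < 0) → 0 < ε j * M i' j := by
    intro j
    by_cases h : ∃ i ∈ S, ε j * M i j < 0
    · obtain ⟨i, hi, hij⟩ := h
      obtain ⟨i', hi', h'⟩ := hrow i hi j hij
      exact ⟨⟨i', hi'⟩, fun _ => h'⟩
    · exact ⟨Classical.arbitrary S, fun h' => absurd h' h⟩
  choose g hg using hg
  -- `f` picks a column with a negative entry, `g` a row positive in that column. On the periodic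
  -- points of `g ∘ f`, rows `e t` and columns `f (e t)` form a square mixed submatrix.
  let P := Function.periodicPts (g ∘ f)
  have hbij : Set.BijOn (g ∘ f) P P := Function.bijOn_periodicPts _
  have hP : P.Nonempty := by
    obtain ⟨m, l, hml, h⟩ := Finite.exists_ne_map_eq_of_infinite
      fun m : ℕ => (g ∘ f)^[m] (Classical.arbitrary S)
    wlog hlt : m < l generalizing m l
    · exact this l m hml.symm h.symm (lt_of_le_of_ne (not_lt.1 hlt) hml.symm)
    refine ⟨(g ∘ f)^[m] (Classical.arbitrary S), l - m, Nat.sub_pos_of_lt hlt, ?_⟩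
    change (g ∘ f)^[l - m] _ = _
    rw [← Function.iterate_add_apply, Nat.sub_add_cancel hlt.le]
    exact h.symm
  have : Nonempty P := hP.to_subtype
  let e : Fin (Nat.card P) ≃ P := (Finite.equivFin P).symm
  have hinj : Function.Injective fun t => f (e t) := fun s t hst =>
    e.injective (Subtype.ext (hbij.injOn (e s).2 (e t).2 (congrArg g hst)))
  refine hM (Nat.card P) Nat.card_pos
    ⟨fun t => ((e t : S) : ι), fun s t hst => e.injective (Subtype.ext (Subtype.ext hst))⟩
    ⟨_, hinj⟩ fun t => ?_
  have hneg := hf (e t)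
  have hpos := hg (f (e t)) ⟨_, (e t : S).2, hneg⟩
  obtain ⟨t', ht'⟩ := e.surjective ⟨_, hbij.mapsTo (e t).2⟩
  have ht'' : (e t' : S) = g (f (e t)) := congrArg Subtype.val ht'
  rw [← ht''] at hpos
  rcases lt_or_ge 0 (ε (f (e t))) with hε | hε
  · exact ⟨⟨t', (mul_pos_iff_of_pos_left hε).1 hpos⟩, ⟨t, by
      change M (e t : S) (f (e t)) < 0
      by_contra hc
      exact absurd hneg (not_lt.2 (mul_nonneg hε.le (not_lt.1 hc)))⟩⟩
  · exact ⟨⟨t, by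
      change 0 < M (e t : S) (f (e t))
      by_contra hc
      exact absurd hneg (not_lt.2 (mul_nonneg_of_nonpos_of_nonpos hε (not_lt.1 hc)))⟩, ⟨t', by
      change M (e t' : S) (f (e t)) < 0
      by_contra hc
      exact absurd hpos (not_lt.2 (mul_nonpos_of_nonpos_of_nonneg hε (not_lt.1 hc)))⟩⟩

/-- A nontrivial combination of the columns of a mixed dominating matrix has a negative entry. -/
theorem IsDominating.exists_mulVec_neg {ι κ : Type*} [Finite ι] [Fintype κ] {M : Matrix ι κ ℝ}
    (hM : IsDominating M) (hmix : IsMixed M) {y : κ → ℝ} (hy : y ≠ 0) :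
    ∃ i, (M *ᵥ y) i < 0 := by
  by_contra! hnn
  have hmix' : ∀ j, y j ≠ 0 → (∃ i, 0 < y j * M i j) ∧ ∃ i, y j * M i j < 0 := by
    intro j hj
    obtain ⟨⟨p, hp⟩, q, hq⟩ := hmix j
    change 0 < M p j at hp
    change M q j < 0 at hq
    rcases lt_or_gt_of_ne hj with h | h
    · exact ⟨⟨q, mul_pos_of_neg_of_neg h hq⟩, p, mul_neg_of_neg_of_pos h hp⟩
    · exact ⟨⟨p, mul_pos h hp⟩, q, mul_neg_of_pos_of_neg h hq⟩
  -- From a row in the set, a column `j` leads by mixedness to a row where its term is negative; as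
  -- the row sum is nonnegative, another term there is positive.
  refine hM.not_alternating (fun j => -y j) (S := {i | ∃ j, 0 < y j * M i j}) (Set.toFinite _)
    ?_ (fun i ⟨j, hj⟩ => ⟨j, by linarith⟩) fun i _ j hij => ?_
  · obtain ⟨j, hj⟩ := Function.ne_iff.1 hy
    obtain ⟨⟨i, hi⟩, -⟩ := hmix' j hj
    exact ⟨i, j, hi⟩
  · have hj : y j ≠ 0 := fun h => by simp [h] at hij
    obtain ⟨-, i', hi'⟩ := hmix' j hj
    refine ⟨i', ?_, by linarith⟩
    by_contra! hnp
    simp only [Set.mem_ofPred_eq, not_exists, not_lt] at hnp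
    refine absurd (hnn i') (not_le.2 ?_)
    simp only [Matrix.mulVec, dotProduct]
    exact Finset.sum_neg' (fun l _ => by rw [mul_comm]; exact hnp l)
      ⟨j, Finset.mem_univ j, by rw [mul_comm]; exact hi'⟩

/-- The sum `p` of negative parts is continuous, positively homogeneous and positive off zero, so it
dominates a multiple of the norm, while the constraints give `p y ≤ ∑ i, |w i|`. -/
theorem exists_bound_of_mulVec_neg {ι κ : Type*} [Fintype ι] [Fintype κ] {M : Matrix ι κ ℝ}
    (hM : ∀ y : κ → ℝ, y ≠ 0 → ∃ i, (M *ᵥ y) i < 0) (w : ι → ℝ) :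
    ∃ R > 0, ∀ y : κ → ℝ, (∀ i, 0 ≤ w i + (M *ᵥ y) i) → ‖y‖ < R := by
  let p : (κ → ℝ) → ℝ := fun y => ∑ i, max (-(M *ᵥ y) i) 0
  have hp : Continuous p := by
    refine continuous_finsetSum _ fun i _ => ?_
    have : Continuous fun y : κ → ℝ => M *ᵥ y := M.mulVecLin.continuous_of_finiteDimensional
    fun_prop
  have hpos : ∀ y, y ≠ 0 → 0 < p y := fun y hy => by
    obtain ⟨i, hi⟩ := hM y hy
    exact Finset.sum_pos' (fun _ _ => le_max_right _ _)
      ⟨i, Finset.mem_univ i, lt_max_of_lt_left (by linarith)⟩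
  have hhom : ∀ (c : ℝ) y, 0 ≤ c → p (c • y) = c * p y := fun c y hc => by
    simp only [p, Matrix.mulVec_smul, Finset.mul_sum, Pi.smul_apply, smul_eq_mul]
    refine Finset.sum_congr rfl fun i _ => ?_
    rw [mul_max_of_nonneg _ _ hc, mul_zero, mul_neg]
  obtain ⟨δ, hδ, hmin⟩ : ∃ δ > 0, ∀ y : κ → ℝ, δ * ‖y‖ ≤ p y := by
    rcases (Metric.sphere (0 : κ → ℝ) 1).eq_empty_or_nonempty with he | he
    · refine ⟨1, one_pos, fun y => ?_⟩
      have : y = 0 := by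
        by_contra hy
        have : ‖y‖⁻¹ • y ∈ Metric.sphere (0 : κ → ℝ) 1 := by
          rw [mem_sphere_zero_iff_norm, norm_smul, norm_inv, norm_norm,
            inv_mul_cancel₀ (norm_ne_zero_iff.2 hy)]
        rw [he] at this
        exact this
      rw [this, norm_zero, mul_zero]
      exact Finset.sum_nonneg fun _ _ => le_max_right _ _
    · obtain ⟨z, hz, hzmin⟩ := (isCompact_sphere (0 : κ → ℝ) 1).exists_isMinOn he hp.continuousOn
      have hz0 : z ≠ 0 := by
        rintro rfl
        simp at hz
      refine ⟨p z, hpos z hz0, fun y => ?_⟩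
      by_cases hy : y = 0
      · rw [hy, norm_zero, mul_zero]
        exact Finset.sum_nonneg fun _ _ => le_max_right _ _
      · have hn : ‖y‖ ≠ 0 := norm_ne_zero_iff.2 hy
        have h1 : p z ≤ p (‖y‖⁻¹ • y) := hzmin (by
          rw [mem_sphere_zero_iff_norm, norm_smul, norm_inv, norm_norm, inv_mul_cancel₀ hn])
        rw [hhom _ _ (inv_nonneg.2 (norm_nonneg y))] at h1
        calc p z * ‖y‖ ≤ ‖y‖⁻¹ * p y * ‖y‖ := by gcongr
          _ = p y := by field_simp
  refine ⟨(∑ i, |w i|) / δ + 1, by positivity, fun y hy => ?_⟩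
  have h1 : p y ≤ ∑ i, |w i| := Finset.sum_le_sum fun i _ =>
    max_le ((by linarith [hy i] : -(M *ᵥ y) i ≤ w i).trans (le_abs_self _)) (abs_nonneg _)
  have h2 : ‖y‖ ≤ (∑ i, |w i|) / δ := by
    rw [le_div_iff₀ hδ, mul_comm]
    exact (hmin y).trans h1
  linarith

/-! ### Solving the logarithmic equations. -/

theorem exists_succ_eq_of_antitone {α : Type*} [Fintype α] {S : ℕ → Finset α}
    (hS : Antitone S) (hne : (S (Fintype.card α)).Nonempty) :
    ∃ s < Fintype.card α, S (s + 1) = S s := by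
  by_contra! h
  have hle : ∀ s ≤ Fintype.card α, (S s).card + s ≤ Fintype.card α := by
    intro s
    induction s with
    | zero => exact fun _ => Finset.card_le_univ _
    | succ s ih =>
      intro hs
      have : (S (s + 1)).card < (S s).card := Finset.card_lt_card ((hS s.le_succ).lt_of_ne (h s hs))
      have := ih (by omega)
      omega
  have := hle _ le_rfl
  have := hne.card_pos
  omega

/-- If a weighted sum of numbers at most `m` is nonpositive while a number of negative weight is
very negative, then some number of positive weight is quite negative. -/
theorem exists_le_neg_of_sum_nonpos {ι : Type*} [Fintype ι] {c u : ι → ℝ} {m T T' K : ℝ}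
    (hm : 0 ≤ m) (hT : 0 ≤ T) (hu : ∀ i, u i ≤ m) (hsum : ∑ i, c i * u i ≤ 0) {i : ι}
    (hi : c i < 0) (hui : u i ≤ -T') (hK : ∑ l, |c l| ≤ K * |c i|)
    (hT' : K * (m + T) < T') : ∃ l, 0 < c l ∧ u l ≤ -T := by
  classical
  by_contra! h
  have hterm : ∀ l, -(|c l| * (m + T)) ≤ c l * u l := by
    intro l
    rcases lt_or_ge 0 (c l) with hl | hl
    · rw [abs_of_pos hl]
      nlinarith [h l hl, mul_nonneg hl.le hm]
    · rw [abs_of_nonpos hl]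
      nlinarith [hu l, mul_nonneg (neg_nonneg.2 hl) hT]
  -- The term at `i` contributes at least `|c i| * T'`, which outweighs all the losses.
  have hterm' : ∀ l, (if l = i then |c i| * T' else 0) - |c l| * (m + T) ≤ c l * u l := by
    intro l
    split_ifs with hl
    · subst hl
      have : 0 ≤ |c l| * (m + T) := by positivity
      rw [abs_of_neg hi] at this ⊢
      nlinarith
    · linarith [hterm l]
  have h1 := Finset.sum_le_sum fun l (_ : l ∈ Finset.univ) => hterm' l
  rw [Finset.sum_sub_distrib, Finset.sum_ite_eq' Finset.univ i, if_pos (Finset.mem_univ i),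
    ← Finset.sum_mul] at h1
  have h2 : (∑ l, |c l|) * (m + T) ≤ K * |c i| * (m + T) := by gcongr
  have h3 : 0 < |c i| := abs_pos.2 hi.ne
  nlinarith

theorem exists_pos_sum_mul_log_eq_zero {ι κ : Type*} [Fintype ι] [Fintype κ]
    {B D : Matrix ι κ ℝ} (hB : IsDominating B) (hmix : IsMixed B)
    (hsgn : ∀ i j, SignType.sign (D i j) = SignType.sign (B i j)) {w : ι → ℝ}
    (hw : ∀ i, 0 < w i) :
    ∃ y : κ → ℝ, (∀ i, 0 < w i + (D *ᵥ y) i) ∧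
      ∀ j, ∑ i, B i j * Real.log (w i + (D *ᵥ y) i) = 0 := by
  have hDpos : ∀ i j, 0 < D i j ↔ 0 < B i j := fun i j => by
    rw [← sign_eq_one_iff, hsgn, sign_eq_one_iff]
  have hDneg : ∀ i j, D i j < 0 ↔ B i j < 0 := fun i j => by
    rw [← sign_eq_neg_one_iff, hsgn, sign_eq_neg_one_iff]
  have hDmix : IsMixed D := fun j => by
    obtain ⟨⟨p, hp⟩, q, hq⟩ := hmix j
    exact ⟨⟨p, (hDpos p j).2 hp⟩, q, (hDneg q j).2 hq⟩
  have hD : IsDominating D := fun r hr f g h => hB r hr f g fun j => by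
    obtain ⟨⟨p, hp⟩, q, hq⟩ := h j
    exact ⟨⟨p, (hDpos _ _).1 hp⟩, q, (hDneg _ _).1 hq⟩
  obtain ⟨R, hR, hbound⟩ := exists_bound_of_mulVec_neg
    (fun y hy => hD.exists_mulVec_neg hDmix hy) w
  have hcont : ∀ i, Continuous fun y : κ → ℝ => w i + (D *ᵥ y) i := fun i => by
    have : Continuous fun y : κ → ℝ => D *ᵥ y := D.mulVecLin.continuous_of_finiteDimensional
    fun_prop
  obtain ⟨W, hW1, hW⟩ : ∃ W ≥ 1, ∀ y : κ → ℝ, ‖y‖ ≤ R → ∀ i, w i + (D *ᵥ y) i ≤ W := by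
    obtain ⟨W, hW⟩ := (isCompact_closedBall (0 : κ → ℝ) R).exists_bound_of_continuousOn
      (f := fun y i => w i + (D *ᵥ y) i) (continuous_pi hcont).continuousOn
    refine ⟨max 1 W, le_max_left _ _, fun y hy i => ?_⟩
    refine (le_abs_self _).trans (((norm_le_pi_norm (fun i => w i + (D *ᵥ y) i) i).trans
      (hW y (by simpa using hy))).trans (le_max_right _ _))
  obtain ⟨T₀, hT₀, hwT₀⟩ : ∃ T₀ : ℝ, 0 ≤ T₀ ∧ ∀ i, Real.exp (-T₀) < w i := by
    refine ⟨∑ i, |Real.log (w i)| + 1, by positivity, fun i => ?_⟩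
    rw [← Real.lt_log_iff_exp_lt (hw i)]
    have h1 := Finset.single_le_sum (f := fun i => |Real.log (w i)|) (fun _ _ => abs_nonneg _)
      (Finset.mem_univ i)
    have h2 := neg_abs_le (Real.log (w i))
    linarith
  obtain ⟨K, hK0, hK⟩ : ∃ K : ℝ, 1 ≤ K ∧ ∀ i j, B i j ≠ 0 → ∑ l, |B l j| ≤ K * |B i j| := by
    -- Summing all ratios bounds each one; zero entries contribute `0` by the convention for
    -- division.
    refine ⟨1 + ∑ i, ∑ j, (∑ l, |B l j|) / |B i j|, ?_, fun i j hij => ?_⟩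
    · have : 0 ≤ ∑ i, ∑ j, (∑ l, |B l j|) / |B i j| := by positivity
      linarith
    · rw [← div_le_iff₀ (abs_pos.2 hij)]
      have h1 := Finset.single_le_sum (f := fun j => (∑ l, |B l j|) / |B i j|)
        (fun _ _ => by positivity) (Finset.mem_univ j)
      have h2 := Finset.single_le_sum (f := fun i => ∑ j, (∑ l, |B l j|) / |B i j|)
        (fun _ _ => by positivity) (Finset.mem_univ i)
      linarith
  have hm : 0 ≤ Real.log W := Real.log_nonneg hW1
  -- Each threshold exceeds `K * (log W + T s)`, as `exists_le_neg_of_sum_nonpos` requires: a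
  -- coordinate below one level forces another below the previous level.
  let T : ℕ → ℝ := fun s => (fun τ => K * (Real.log W + τ) + 1)^[s] T₀
  have hTsucc : ∀ s, T (s + 1) = K * (Real.log W + T s) + 1 := fun s =>
    Function.iterate_succ_apply' _ _ _
  have hT0 : ∀ s, 0 ≤ T s := fun s => by
    induction s with
    | zero => exact hT₀
    | succ s ih => rw [hTsucc]; positivity
  have hTmono : Monotone T := monotone_nat_of_le_succ fun s => by
    rw [hTsucc]
    nlinarith [hT0 s]
  let τ := T (Fintype.card ι)
  let u : (κ → ℝ) → ι → ℝ := fun y i => Real.log (max (w i + (D *ᵥ y) i) (Real.exp (-τ)))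
  have hmaxpos : ∀ y i, 0 < max (w i + (D *ᵥ y) i) (Real.exp (-τ)) := fun y i =>
    lt_max_of_lt_right (Real.exp_pos _)
  have hucont : ∀ i, Continuous fun y => u y i := fun i =>
    ((hcont i).max continuous_const).log fun y => (hmaxpos y i).ne'
  obtain ⟨y, hy⟩ := exists_box_complementarity (G := fun y j => ∑ i, B i j * u y i)
    (continuous_pi fun j => continuous_finsetSum _ fun i _ => continuous_const.mul (hucont i)) hR
  have hyR : ‖y‖ ≤ R := (pi_norm_le_iff_of_nonneg hR.le).2 fun j => (hy j).1
  have hcomp : ∀ j, ∑ i, (y j * B i j) * u y i ≤ 0 := fun j => by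
    simp_rw [mul_assoc]
    rw [← Finset.mul_sum]
    rcases (hy j).2 with h | ⟨h, h'⟩ | ⟨h, h'⟩
    · rw [h, mul_zero]
    · exact mul_nonpos_of_nonneg_of_nonpos (h ▸ hR.le) h'
    · exact mul_nonpos_of_nonpos_of_nonneg (by rw [h]; linarith) h'
  have hum : ∀ i, u y i ≤ Real.log W := fun i =>
    Real.log_le_log (hmaxpos y i) (max_le (hW y hyR i)
      ((Real.exp_le_one_iff.2 (neg_nonpos.2 (hT0 _))).trans hW1))
  have hlarge : ∀ i, Real.exp (-τ) < w i + (D *ᵥ y) i := by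
    by_contra! hsmall
    obtain ⟨i₀, hi₀⟩ := hsmall
    let S : ℕ → Finset ι := fun s => {i | u y i ≤ -T s}
    have hSanti : Antitone S := fun s t hst i hi => by
      simp only [S, Finset.mem_filter, Finset.mem_univ, true_and] at hi ⊢
      linarith [hTmono hst]
    -- There are more levels than rows, so two consecutive level sets agree; the loss of one level
    -- per step then costs nothing and the set is closed under walking.
    obtain ⟨s, hsn, hs⟩ := exists_succ_eq_of_antitone hSanti ⟨i₀, by
      simp only [S, u, Finset.mem_filter, Finset.mem_univ, true_and]
      rw [max_eq_right hi₀, Real.log_exp]⟩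
    refine hB.not_alternating y (S := {i | u y i ≤ -T s}) (Set.toFinite _) ⟨i₀, ?_⟩ ?_ ?_
    · change Real.log (max (w i₀ + (D *ᵥ y) i₀) (Real.exp (-τ))) ≤ -T s
      rw [max_eq_right hi₀, Real.log_exp]
      exact neg_le_neg (hTmono hsn.le)
    · intro i hi
      -- A tiny coordinate is below `w i`, so `(D y) i` is negative and has a negative term.
      have h1 : w i + (D *ᵥ y) i < w i := by
        refine lt_of_le_of_lt ?_ (hwT₀ i)
        refine (le_max_left _ (Real.exp (-τ))).trans ?_
        rw [← Real.log_le_iff_le_exp (hmaxpos y i)]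
        exact (show u y i ≤ -T s from hi).trans (neg_le_neg (hTmono (Nat.zero_le s)))
      have h2 : ∑ j, D i j * y j < 0 := by
        have : (D *ᵥ y) i = ∑ j, D i j * y j := rfl
        linarith
      obtain ⟨j, -, hj⟩ := Finset.exists_lt_of_sum_lt (h2.trans_eq Finset.sum_const_zero.symm)
      refine ⟨j, ?_⟩
      rcases mul_neg_iff.1 hj with ⟨h3, h4⟩ | ⟨h3, h4⟩
      · exact mul_neg_of_neg_of_pos h4 ((hDpos i j).1 h3)
      · exact mul_neg_of_pos_of_neg h4 ((hDneg i j).1 h3)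
    · intro i hi j hij
      have hi' : u y i ≤ -T (s + 1) := by
        have : i ∈ S (s + 1) := by
          rw [hs]
          simpa [S] using hi
        simpa [S] using this
      obtain ⟨l, hl, hul⟩ := exists_le_neg_of_sum_nonpos (K := K) hm (hT0 s) hum (hcomp j) hij hi'
        (by
          simp_rw [abs_mul]
          rw [← Finset.mul_sum, mul_left_comm]
          exact mul_le_mul_of_nonneg_left (hK i j (fun h => by simp [h] at hij)) (abs_nonneg _))
        (by rw [hTsucc]; linarith)
      exact ⟨l, hul, hl⟩
  have hpos : ∀ i, 0 < w i + (D *ᵥ y) i := fun i => (Real.exp_pos _).trans (hlarge i)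
  refine ⟨y, hpos, fun j => ?_⟩
  -- Positivity of `w + D y` keeps `y` strictly inside the box, so only the equation survives among
  -- the complementarity alternatives.
  have hyj : |y j| < R := lt_of_le_of_lt (norm_le_pi_norm y j) (hbound y fun i => (hpos i).le)
  have hz : ∑ i, B i j * u y i = 0 := by
    rcases (hy j).2 with h | ⟨h, -⟩ | ⟨h, -⟩
    · exact h
    · rw [h, abs_of_pos hR] at hyj
      exact absurd hyj (lt_irrefl _)
    · rw [h, abs_neg, abs_of_pos hR] at hyj
      exact absurd hyj (lt_irrefl _)
  rw [← hz]
  refine Finset.sum_congr rfl fun i _ => ?_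
  simp only [u]
  rw [max_eq_left (hlarge i).le]

/-! ### Gale duality and the return to the polynomial system. -/

/-- A vector orthogonal to the kernel of a matrix lies in its row space. -/
theorem Matrix.exists_vecMul_eq_of_ker {m n : Type*} [Fintype m] [Fintype n]
    (A : Matrix m n ℝ) {L : n → ℝ} (hL : ∀ v, A *ᵥ v = 0 → L ⬝ᵥ v = 0) :
    ∃ c : m → ℝ, ∀ j, L j = ∑ i, c i * A i j := by
  classical
  have hmem : dotProductBilin ℝ ℝ L ∈ (LinearMap.ker A.mulVecLin).dualAnnihilator := by
    rw [Submodule.mem_dualAnnihilator]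
    intro v hv
    exact hL v hv
  rw [← LinearMap.range_dualMap_eq_dualAnnihilator_ker] at hmem
  obtain ⟨ψ, hψ⟩ := hmem
  refine ⟨fun i => ψ fun j => if i = j then 1 else 0, fun j => ?_⟩
  have h1 : ψ (A *ᵥ Pi.single j 1) = L ⬝ᵥ Pi.single j 1 := congrArg (fun l => l (Pi.single j 1)) hψ
  rw [dotProduct_single, mul_one, Matrix.mulVec_single_one] at h1
  rw [← h1, LinearMap.pi_apply_eq_sum_univ ψ]
  refine Finset.sum_congr rfl fun i _ => ?_
  rw [smul_eq_mul, mul_comm]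
  rfl

theorem IsGaleDual.mulVec_col {r s t : ℕ} {M : Matrix (Fin r) (Fin s) ℝ}
    {N : Matrix (Fin s) (Fin t) ℝ} (h : IsGaleDual M N) (j : Fin t) : M *ᵥ N.col j = 0 := by
  have : N.col j ∈ LinearMap.ker M.mulVecLin := by
    rw [← h.2.2.2]
    exact Submodule.subset_span ⟨j, rfl⟩
  exact this

/-- A Gale dual matrix of a point configuration is mixed: its columns are nonzero with sum zero. -/
theorem IsGaleDual.isMixed {d n k : ℕ} {a : Fin n → Fin d → ℝ} {B : Matrix (Fin n) (Fin k) ℝ}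
    (hB : IsGaleDual (configMatrix a) B) : IsMixed B := by
  intro j
  have hsum : ∑ i, B.col j i = 0 := by
    have h := congrFun (hB.mulVec_col j) 0
    simpa [Matrix.mulVec, dotProduct, configMatrix] using h
  have hne : B.col j ≠ 0 := hB.2.2.1.ne_zero j
  obtain ⟨i, hi⟩ := Function.ne_iff.1 hne
  constructor
  · exact (Finset.exists_pos_of_sum_zero_of_exists_nonzero _ hsum ⟨i, Finset.mem_univ i, hi⟩).imp
      fun _ h => h.2
  · obtain ⟨l, -, hl⟩ := Finset.exists_pos_of_sum_zero_of_exists_nonzero (fun i => -B.col j i)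
      (by rw [Finset.sum_neg_distrib, hsum, neg_zero]) ⟨i, Finset.mem_univ i, neg_ne_zero.2 hi⟩
    exact ⟨l, neg_pos.1 hl⟩

/-- A positive kernel vector of `C` whose logarithm is orthogonal to the Gale dual matrix yields a
positive solution of the system. -/
theorem positiveSolutions_nonempty_of_log {d n k : ℕ} {a : Fin n → Fin d → ℝ}
    {C : Matrix (Fin d) (Fin n) ℝ} {B : Matrix (Fin n) (Fin k) ℝ}
    (hB : IsGaleDual (configMatrix a) B) {w : Fin n → ℝ} (hw : ∀ j, 0 < w j)
    (hC : C *ᵥ w = 0) (hlog : ∀ j, ∑ i, B i j * Real.log (w i) = 0) :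
    (positiveSolutions a C).Nonempty := by
  obtain ⟨c, hc⟩ := (configMatrix a).exists_vecMul_eq_of_ker (L := fun i => Real.log (w i)) (by
    intro v hv
    have hle : Submodule.span ℝ (Set.range B.col) ≤
        LinearMap.ker (dotProductBilin ℝ ℝ fun i => Real.log (w i)) := by
      rw [Submodule.span_le]
      rintro _ ⟨j, rfl⟩
      change (fun i => Real.log (w i)) ⬝ᵥ B.col j = 0
      rw [← hlog j]
      exact Finset.sum_congr rfl fun i _ => mul_comm _ _
    exact hle (hB.2.2.2.symm ▸ hv))
  -- The coefficient `c 0` of the row of ones only scales all monomials by `exp (-c 0)`, which the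
  -- homogeneous linear equations ignore.
  refine ⟨fun l => Real.exp (c l.succ), fun l => Real.exp_pos _, fun i => ?_⟩
  have hmon : ∀ j, ∏ l, Real.exp (c l.succ) ^ a j l = Real.exp (-c 0) * w j := by
    intro j
    have h := hc j
    rw [Fin.sum_univ_succ] at h
    simp only [configMatrix, Matrix.of_apply, Fin.cons_zero, Fin.cons_succ, mul_one] at h
    simp_rw [← Real.exp_mul]
    rw [← Real.exp_sum, ← Real.exp_log (hw j), ← Real.exp_add, h]
    congr 1
    rw [neg_add_cancel_left]
  simp_rw [hmon]
  have h : ∑ j, C i j * w j = 0 := congrFun hC i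
  rw [Finset.sum_congr rfl fun j _ => mul_left_comm (C i j) _ (w j), ← Finset.mul_sum, h, mul_zero]

theorem theorem4p4 {d n k : ℕ} (a : Fin n → Fin d → ℝ) (ha : Function.Injective a)
    (C : Matrix (Fin d) (Fin n) ℝ)
    (hA : IsUniform (configMatrix a)) (hC : IsUniform C)
    (B : Matrix (Fin n) (Fin k) ℝ) (hB : IsGaleDual (configMatrix a) B) (hdom : IsDominating B)
    (h0 : (0 : Fin d → ℝ) ∈ openCone C)
    (hsign : ∀ j, signVec (B.col j) ∈
      signVec '' (LinearMap.ker C.mulVecLin : Set (Fin n → ℝ))) :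
    0 < numPositiveSolutions a C := by
  obtain ⟨w, hw, hCw⟩ := h0
  choose v hv hvsign using hsign
  let D : Matrix (Fin n) (Fin k) ℝ := Matrix.of fun i j => v j i
  obtain ⟨y, hy, hlog⟩ := exists_pos_sum_mul_log_eq_zero (D := D) hdom hB.isMixed
    (fun i j => congrFun (hvsign j) i) hw
  refine Set.encard_pos.2 (positiveSolutions_nonempty_of_log hB hy ?_ hlog)
  have h1 : C *ᵥ w = 0 := by
    rw [hCw]
    ext i
    simp [Matrix.mulVec, dotProduct, mul_comm]
  have h2 : C *ᵥ (D *ᵥ y) = 0 := by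
    have : C * D = 0 := by
      ext i j
      exact congrFun (show C *ᵥ v j = 0 from hv j) i
    rw [Matrix.mulVec_mulVec, this, Matrix.zero_mulVec]
  change C *ᵥ (w + D *ᵥ y) = 0
  rw [Matrix.mulVec_add, h1, h2, add_zero]
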